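/- Let $n\ge 1$, $d=2^n$, let $H$ be a Hermitian operator on the Hilbert space $(\mathbb C^2)^{\otimes n}$ of $n$ qubits, let $\Delta t\in\mathbb R$, let $N\ge 1$ be an integer and $T=N\Delta t$. Let $U=U(\Delta t)$ be any unitary on this space, intended to approximate $e^{-iH\Delta t}$, and put $\epsilon^{TS}_\infty=\|e^{-iH\Delta t}-U\|_\infty$ (operator norm). Let $V=WD(\gamma)W^\dagger$, where $W$ is unitary and $D(\gamma)$ is the diagonal unitary with eigenphases $\gamma\in\mathbb R^d$, that is $D(\gamma)_{zz}=e^{i\gamma_z}$, and let $V(T)=WD(N\gamma)W^\dagger$ be the fast-forwarded simulation. For unitaries $U,V$ let $C_{LHST}(U,V)=1-\frac1n\sum_{j=1}^n F_e^{(j)}$, where $F_e^{(j)}=\mathrm{Tr}\big(|\Phi^+\rangle\langle\Phi^+|\,(\mathcal E_j\otimes\mathcal I)(|\Phi^+\rangle\langle\Phi^+|)\big)$ with $|\Phi^+\rangle=(|00\rangle+|11\rangle)/\sqrt2$, and where $\mathcal E_j$ is the one-qubit channel $\mathcal E_j(\rho)=\mathrm{Tr}_{\bar j}\big(UV^\dagger(\rho_j\otimes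 \mathbb 1_{\bar j}/2^{n-1})VU^\dagger\big)$, with $\bar j$ denoting all qubits except the $j$-th. Write $C=C_{LHST}(U,V)$ and $$\overline F(T)=\int_\psi\big|\langle\psi|V(T)^\dagger e^{-iHT}|\psi\rangle\big|^2\,d\psi,\qquad G(f)=\sqrt{1-\sqrt{1-\tfrac{d+1}{d}(1-f)}},$$ where $d\psi$ is the Haar probability measure on pure states. If $nC\le1$, write also $$\epsilon=\frac{\epsilon^{TS}_\infty}{\sqrt2}+\sqrt{1-\sqrt{1-nC}} .$$ Then: (0) $\frac1{d+1}\le\overline F(T)\le1$; in particular $G(\overline F(T))$ is real. (1) If $nC\le1$, then $G(\overline F(T))\le \frac{N}{\sqrt2}\epsilon^{TS}_\infty+N\sqrt{1-\sqrt{1-nC}}$. (2) If $nC\le1$ and $N\epsilon\le1$, then $$\overline F(T)\ge\frac1{d+1}+\frac d{d+1}\big(1-N^2\epsilon^2\big)^2,\qquad \overline F(T)\ge1-\frac{2N^2d}{d+1}\,\epsilon^2,$$ and also $\overline F(T)\ge1-\frac{N^2d}{d+1}\big(\epsilon^{TS}_\infty+\sqrt{2nC}\big)^2$. (3) Let $f\in[\frac1{d+1},1]$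 be a prescribed fidelity whose gap is not already exceeded by the Trotter error alone, that is $\frac1{\sqrt2}\epsilon^{TS}_\infty\le\frac1N G(f)$. If $$C\le C_{\rm Threshold}:=\frac1n\left(1-\left(1-\Big(\frac1N G(f)-\frac1{\sqrt2}\epsilon^{TS}_\infty\Big)^2\right)^2\right),$$ then $\overline F(T)\ge f$. -/

import Mathlib

open MeasureTheory
open scoped Kronecker

noncomputable section

namespace VFF

/-- Computational basis labels of `n` qubits: bit strings of length `n`. -/
abbrev Bits (n : ℕ) : Type := Fin n → Fin 2

/-- Operators on the `2 ^ n`-dimensional Hilbert space of `n` qubits. -/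
abbrev Op (n : ℕ) : Type := Matrix (Bits n) (Bits n) ℂ

/-- The Hilbert space of `n` qubits, with its Euclidean norm. -/
abbrev State (n : ℕ) : Type := EuclideanSpace ℂ (Bits n)

/-! ### Entanglement fidelities and the local Hilbert-Schmidt cost -/

/-- Density matrix of the two-qubit Bell state `(|00⟩ + |11⟩) / √2`. -/
def bellProjector : Matrix (Fin 2 × Fin 2) (Fin 2 × Fin 2) ℂ :=
  let Φ : Fin 2 × Fin 2 → ℂ := fun p => if p.1 = p.2 then ((Real.sqrt 2)⁻¹ : ℝ) else 0
  Matrix.vecMulVec Φ (star Φ)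

/-- The basis label of `n` qubits, split into the bit of qubit `j` and the bits of all the
other qubits. -/
def splitQubit {n : ℕ} (j : Fin n) : Bits n ≃ Fin 2 × ({k : Fin n // k ≠ j} → Fin 2) :=
  Equiv.funSplitAt j (Fin 2)

/-- `ρ ⊗ 𝟙 / 2 ^ (n - 1)`: the one-qubit operator `ρ` on qubit `j`, and the maximally mixed
state on all the other qubits. -/
def padMaximallyMixed {n : ℕ} (j : Fin n) (ρ : Matrix (Fin 2) (Fin 2) ℂ) : Op n :=
  (ρ ⊗ₖ ((1 / 2 ^ (n - 1) : ℂ) •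
    (1 : Matrix ({k : Fin n // k ≠ j} → Fin 2) ({k : Fin n // k ≠ j} → Fin 2) ℂ))).submatrix
      (splitQubit j) (splitQubit j)

/-- Partial trace over all qubits except qubit `j`. -/
def partialTraceOthers {n : ℕ} (j : Fin n) (M : Op n) : Matrix (Fin 2) (Fin 2) ℂ :=
  Matrix.of fun a b => ∑ r : {k : Fin n // k ≠ j} → Fin 2,
    M ((splitQubit j).symm (a, r)) ((splitQubit j).symm (b, r))

/-- The one-qubit channel
`ρ ↦ Tr_{others} (U V† (ρ ⊗ 𝟙 / 2 ^ (n - 1)) V U†)` on qubit `j`. -/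
def localChannel {n : ℕ} (U V : Op n) (j : Fin n) :
    Matrix (Fin 2) (Fin 2) ℂ →ₗ[ℂ] Matrix (Fin 2) (Fin 2) ℂ where
  toFun ρ := partialTraceOthers j
    (U * V.conjTranspose * padMaximallyMixed j ρ * (V * U.conjTranspose))
  map_add' ρ σ := by
    have h : padMaximallyMixed j (ρ + σ) = padMaximallyMixed j ρ + padMaximallyMixed j σ := by
      ext x y; simp [padMaximallyMixed, Matrix.kroneckerMap_apply, add_mul]
    rw [h]; ext a b
    simp [partialTraceOthers, Matrix.mul_add, Matrix.add_mul, Finset.sum_add_distrib]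
  map_smul' c ρ := by
    have h : padMaximallyMixed j (c • ρ) = c • padMaximallyMixed j ρ := by
      ext x y; simp [padMaximallyMixed, Matrix.kroneckerMap_apply, mul_assoc]
    rw [h]; ext a b
    simp [partialTraceOthers, Finset.mul_sum]

/-- `(E ⊗ I)(X)` for a linear map `E` on one-qubit operators and a two-qubit operator `X`:
`E` acts on each block of `X` with fixed indices of the second qubit. -/
def ampliate (E : Matrix (Fin 2) (Fin 2) ℂ →ₗ[ℂ] Matrix (Fin 2) (Fin 2) ℂ)
    (X : Matrix (Fin 2 × Fin 2) (Fin 2 × Fin 2) ℂ) :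
    Matrix (Fin 2 × Fin 2) (Fin 2 × Fin 2) ℂ :=
  Matrix.of fun p q => E (Matrix.of fun s t => X (s, p.2) (t, q.2)) p.1 q.1

/-- The entanglement fidelity `F_e^{(j)}` of the local channel at qubit `j`
(the trace is a real number). -/
def entanglementFidelity {n : ℕ} (U V : Op n) (j : Fin n) : ℝ :=
  (bellProjector * ampliate (localChannel U V j) bellProjector).trace.re

/-- The local Hilbert-Schmidt test cost `C_LHST(U, V) = 1 - (1/n) ∑_j F_e^{(j)}`. -/
def costLHST {n : ℕ} (U V : Op n) : ℝ :=
  1 - (1 / (n : ℝ)) * ∑ j : Fin n, entanglementFidelity U V j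

/-! ### Evolution, ansatz, and simulation error -/

/-- Time evolution `e^{-i H t}`. -/
def evolution {n : ℕ} (H : Op n) (t : ℝ) : Op n :=
  NormedSpace.exp ((-(Complex.I * (t : ℂ))) • H)

/-- The diagonal unitary `D(γ)` with eigenphases `γ`. -/
def diagonalUnitary {n : ℕ} (γ : Bits n → ℝ) : Op n :=
  Matrix.diagonal fun z => Complex.exp (Complex.I * (γ z : ℂ))

/-- The diagonalized ansatz `W D(γ) W†`. Fast-forwarding by `N` steps replaces `γ` by `N γ`. -/
def ansatz {n : ℕ} (W : Op n) (γ : Bits n → ℝ) : Op n :=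
  W * diagonalUnitary γ * W.conjTranspose

/-- The Schatten `∞`-norm, that is the operator norm on the Hilbert space of `n` qubits. -/
def operatorNorm {n : ℕ} (M : Op n) : ℝ :=
  ‖Matrix.toEuclideanCLM (n := Bits n) (𝕜 := ℂ) M‖

/-- The one-step (Trotter) simulation error `‖e^{-i H Δt} - U‖_∞`. -/
def trotterError {n : ℕ} (H : Op n) (Δt : ℝ) (U : Op n) : ℝ :=
  operatorNorm (evolution H Δt - U)

/-! ### Haar-averaged fidelity -/

/-- The Haar (unitarily invariant) probability measure on the pure states of `n` qubits: the
normalized surface measure of the unit sphere of the Hilbert space. -/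
def haarState (n : ℕ) : Measure (Metric.sphere (0 : State n) 1) :=
  ((volume : Measure (State n)).toSphere Set.univ)⁻¹ • (volume : Measure (State n)).toSphere

theorem isProbabilityMeasure_haarState (n : ℕ) : IsProbabilityMeasure (haarState n) := by
  constructor
  rw [haarState, Measure.smul_apply, smul_eq_mul]
  refine ENNReal.inv_mul_cancel ?_ (measure_ne_top _ _)
  exact fun h => (Measure.toSphere_ne_zero (μ := (volume : Measure (State n))))
    (Measure.measure_univ_eq_zero.1 h)

/-- The average fidelity `∫ |⟨U₁ψ, U₂ψ⟩|² dψ` over Haar-random pure states `ψ`. -/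
def averageFidelity {n : ℕ} (U₁ U₂ : Op n) : ℝ :=
  ∫ ψ : Metric.sphere (0 : State n) 1,
    ‖inner ℂ (Matrix.toEuclideanCLM (n := Bits n) (𝕜 := ℂ) U₁ (ψ : State n))
      (Matrix.toEuclideanCLM (n := Bits n) (𝕜 := ℂ) U₂ (ψ : State n))‖ ^ 2 ∂(haarState n)

/-! ### Explicit functions in the bounds -/

/-- `G(f) = √(1 - √(1 - ((d + 1) / d) (1 - f)))` with `d = 2 ^ n`. -/
def fidelityGap (n : ℕ) (f : ℝ) : ℝ :=
  Real.sqrt (1 - Real.sqrt (1 - ((2 : ℝ) ^ n + 1) / 2 ^ n * (1 - f)))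

/-- `ε = ε_TS / √2 + √(1 - √(1 - n C))`. -/
def stepError (n : ℕ) (εTS C : ℝ) : ℝ :=
  εTS / Real.sqrt 2 + Real.sqrt (1 - Real.sqrt (1 - n * C))

/-- The threshold `(1/n) (1 - (1 - (G(f) / N - ε_TS / √2)²)²)` for the target fidelity `f`. -/
def costThreshold (n N : ℕ) (εTS f : ℝ) : ℝ :=
  1 / (n : ℝ) * (1 - (1 - (1 / (N : ℝ) * fidelityGap n f - 1 / Real.sqrt 2 * εTS) ^ 2) ^ 2)

end VFF

end

noncomputable section

namespace VFF

/-! ### Haar moments and the average fidelity -/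

/-! For unitaries `A`, `B` put `t = |Tr(A†B)| / d`. Everything factors through `t`. The fourth
moments of a Haar-random state give `F = 1/(d+1) + d/(d+1) · t²` (`averageFidelity_eq`), so `G(F) =
√(1 - t)`. This is, up to the factor `√(2d)`, the Hilbert-Schmidt distance of `A` and `B` minimized
over a global phase (`exists_phase_norm_vec_sub_sq`). Hence `G` inherits a triangle inequality, and
it grows at most linearly in the number of steps because the Hilbert-Schmidt norm is unitarily
invariant (`norm_vec_pow_sub_pow_le`).

The one-step distance splits at `U`. The Trotter part follows from `‖X‖_HS ≤ √d ‖X‖_∞`. The learning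
part needs `1 - t² ≤ n C` for the pair `U`, `V` (`one_sub_overlap_le_cost`). For `M = UV†`, the
local fidelity at qubit `j` is `‖P_j M‖² / d`, with `P_j` the projection onto operators trivial on
qubit `j`. The `P_j` commute and their product projects onto the scalars, where the squared norm is
`|Tr M|² / d`; a union bound over the `P_j` concludes.

The moments need no representation theory: phases kill the unpaired ones, one reflection relates the
remaining ones, and the identity operator fixes the last constant. -/

open scoped Pointwise in
/-- A real-linear isometry of the Hilbert space preserves the Haar measure on pure states. -/
theorem integral_haarState_comp_isometry {n : ℕ} (f : State n ≃ₗᵢ[ℝ] State n) (g : State n → ℂ) :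
    ∫ ψ : Metric.sphere (0 : State n) 1, g (f ψ) ∂(haarState n) =
      ∫ ψ : Metric.sphere (0 : State n) 1, g ψ ∂(haarState n) := by
  have hvol : MeasurePreserving f (volume : Measure (State n)) volume :=
    LinearIsometryEquiv.measurePreserving f
  let e : Metric.sphere (0 : State n) 1 ≃ₜ Metric.sphere (0 : State n) 1 :=
    f.toHomeomorph.subtype (fun x => by simp)
  have he : ∀ ψ, (e ψ : State n) = f ψ := fun ψ => rfl
  -- The surface measure of `s` is, up to a constant, the volume of the cone `(0,1) • s`. A linear
  -- isometry carries cones to cones and preserves volume.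
  have hs : MeasurePreserving e (haarState n) (haarState n) := by
    refine ⟨e.continuous.measurable, ?_⟩
    ext s hs
    rw [Measure.map_apply e.continuous.measurable hs, haarState, Measure.smul_apply,
      Measure.smul_apply, Measure.toSphere_apply' _ hs,
      Measure.toSphere_apply' _ (e.continuous.measurable hs)]
    congr 2
    rw [← MeasurePreserving.measure_preimage_equiv (f := f.toHomeomorph.toMeasurableEquiv) hvol
      (Set.Ioo (0 : ℝ) 1 • (Subtype.val '' s))]
    congr 1
    ext x
    simp only [Set.mem_smul, Set.mem_image, Set.mem_preimage]
    constructor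
    · rintro ⟨r, hr, _, ⟨y, hy, rfl⟩, rfl⟩
      exact ⟨r, hr, _, ⟨e y, hy, rfl⟩, (map_smul f r _).symm⟩
    · rintro ⟨r, hr, _, ⟨y, hy, rfl⟩, h⟩
      refine ⟨r, hr, _, ⟨e.symm y, by simpa using hy, rfl⟩, f.injective ?_⟩
      rw [map_smul, ← he, e.apply_symm_apply, h]
      rfl
  exact hs.integral_comp e.measurableEmbedding (fun ψ => g ψ)

theorem integrable_haarState {n : ℕ} {g : State n → ℂ} (hg : Continuous g) :
    Integrable (fun ψ : Metric.sphere (0 : State n) 1 => g ψ) (haarState n) := by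
  have := isProbabilityMeasure_haarState n
  exact (hg.comp continuous_subtype_val).integrable_of_hasCompactSupport
    (HasCompactSupport.of_compactSpace _)

/-- The fourth-order moments `∫ ψ̄ᵢ ψⱼ ψₖ ψ̄ₗ dψ` of a Haar-random state. -/
def haarMoment {n : ℕ} (i j k l : Bits n) : ℂ :=
  ∫ ψ : Metric.sphere (0 : State n) 1,
    star ((ψ : State n) i) * (ψ : State n) j * (ψ : State n) k * star ((ψ : State n) l)
      ∂(haarState n)

/-- Multiplication of one coordinate by `i`. -/
def phaseAt {n : ℕ} (m : Bits n) : State n ≃ₗᵢ[ℝ] State n :=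
  LinearIsometryEquiv.piLpCongrRight 2 fun k =>
    rotation (if k = m then ⟨Complex.I, mem_sphere_zero_iff_norm.2 Complex.norm_I⟩ else 1)

theorem phaseAt_apply {n : ℕ} (m k : Bits n) (ψ : State n) :
    phaseAt m ψ k = (if k = m then Complex.I else 1) * ψ k := by
  by_cases h : k = m <;>
    simp [phaseAt, LinearIsometryEquiv.piLpCongrRight_apply, rotation_apply, h]

theorem haarMoment_phase {n : ℕ} (m i j k l : Bits n) :
    haarMoment i j k l = star (if i = m then Complex.I else 1) * (if j = m then Complex.I else 1) *
      (if k = m then Complex.I else 1) * star (if l = m then Complex.I else 1) *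
      haarMoment i j k l := by
  conv_lhs => rw [haarMoment, ← integral_haarState_comp_isometry (phaseAt m)
    (fun ψ => star (ψ i) * ψ j * ψ k * star (ψ l))]
  rw [haarMoment, ← integral_const_mul]
  congr 1
  ext ψ
  simp only [phaseAt_apply, star_mul]
  ring

/-- Each unpaired moment is multiplied by some factor other than 1 under a phase on one well-chosen
coordinate. The phase `i` is used because a sign change would not detect `ψ̄ᵢ² ψⱼ ψₖ` with `j`, `k`
different from `i`. -/
theorem haarMoment_eq_zero {n : ℕ} {i j k l : Bits n} (h₁ : ¬ (i = j ∧ k = l))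
    (h₂ : ¬ (i = k ∧ j = l)) : haarMoment i j k l = 0 := by
  have hI : (Complex.I) ≠ 1 := by simp [Complex.ext_iff]
  have hI' : (-Complex.I) ≠ 1 := by simp [Complex.ext_iff]
  have hneg : ((-1 : ℂ)) ≠ 1 := by norm_num
  have key : ∀ {c x : ℂ}, c ≠ 1 → x = c * x → x = 0 := by
    intro c x hc hx
    have : (c - 1) * x = 0 := by rw [sub_mul, ← hx]; ring
    exact (mul_eq_zero.1 this).resolve_left (sub_ne_zero.2 hc)
  by_cases hij : i = j
  · subst hij
    have hkl : k ≠ l := fun h => h₁ ⟨rfl, h⟩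
    refine key ?_ (haarMoment_phase k i i k l)
    by_cases hik : i = k <;> simp [hik, hkl.symm, hI]
  · by_cases hik : i = k
    · subst hik
      have hjl : j ≠ l := fun h => h₂ ⟨rfl, h⟩
      refine key ?_ (haarMoment_phase j i j i l)
      simp [hij, hjl.symm, hI]
    · refine key ?_ (haarMoment_phase i i j k l)
      by_cases hil : l = i <;> simp [hil, Ne.symm hij, Ne.symm hik, hI', hneg]

theorem haarMoment_swap {n : ℕ} (i j k l : Bits n) : haarMoment i j k l = haarMoment i k j l := by
  simp only [haarMoment]
  congr 1; ext ψ; ring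

theorem haarMoment_comm {n : ℕ} (i j : Bits n) : haarMoment i i j j = haarMoment j j i i := by
  simp only [haarMoment]
  congr 1; ext ψ; ring

theorem integral_haarState_quartic {n : ℕ} {κ : Type*} [Fintype κ] (e : κ → Bits n)
    (T : κ → κ → κ → κ → ℂ) :
    ∫ ψ : Metric.sphere (0 : State n) 1, ∑ a, ∑ b, ∑ c, ∑ d, T a b c d *
      (star ((ψ : State n) (e a)) * (ψ : State n) (e b) * (ψ : State n) (e c) *
        star ((ψ : State n) (e d))) ∂(haarState n) =
      ∑ a, ∑ b, ∑ c, ∑ d, T a b c d * haarMoment (e a) (e b) (e c) (e d) := by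
  have hint : ∀ a b c d, Integrable (fun ψ : Metric.sphere (0 : State n) 1 => T a b c d *
      (star ((ψ : State n) (e a)) * (ψ : State n) (e b) * (ψ : State n) (e c) *
        star ((ψ : State n) (e d)))) (haarState n) := fun a b c d =>
    integrable_haarState (g := fun ψ : State n => T a b c d *
      (star (ψ (e a)) * ψ (e b) * ψ (e c) * star (ψ (e d)))) (by fun_prop)
  rw [integral_finsetSum _ fun a _ => integrable_finsetSum _ fun b _ =>
    integrable_finsetSum _ fun c _ => integrable_finsetSum _ fun d _ => hint a b c d]
  refine Finset.sum_congr rfl fun a _ => ?_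
  rw [integral_finsetSum _ fun b _ =>
    integrable_finsetSum _ fun c _ => integrable_finsetSum _ fun d _ => hint a b c d]
  refine Finset.sum_congr rfl fun b _ => ?_
  rw [integral_finsetSum _ fun c _ => integrable_finsetSum _ fun d _ => hint a b c d]
  refine Finset.sum_congr rfl fun c _ => ?_
  rw [integral_finsetSum _ fun d _ => hint a b c d]
  exact Finset.sum_congr rfl fun d _ => integral_const_mul _ _

/-- Of the sixteen terms of the expansion, the two pure ones survive, together with the four mixed
ones that pair each conjugated factor with an unconjugated one. -/
theorem integral_haarState_two_coordinates {n : ℕ} {i j : Bits n} (hij : i ≠ j) (p q : ℝ) :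
    ∫ ψ : Metric.sphere (0 : State n) 1,
      star (p * (ψ : State n) i + q * (ψ : State n) j) *
        (p * (ψ : State n) i + q * (ψ : State n) j) *
        (p * (ψ : State n) i + q * (ψ : State n) j) *
        star (p * (ψ : State n) i + q * (ψ : State n) j) ∂(haarState n) =
      p ^ 4 * haarMoment i i i i + q ^ 4 * haarMoment j j j j +
        4 * (p ^ 2 * q ^ 2) * haarMoment i i j j := by
  have h := integral_haarState_quartic (κ := Fin 2) ![i, j]
    (fun a b c d => (![p, q] a : ℂ) * (![p, q] b : ℂ) * (![p, q] c : ℂ) * (![p, q] d : ℂ))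
  simp only [Fin.sum_univ_two, Matrix.cons_val_zero, Matrix.cons_val_one] at h
  have z₁ : haarMoment i i i j = 0 := haarMoment_eq_zero (by simp [hij]) (by simp [hij])
  have z₂ : haarMoment j i i i = 0 := haarMoment_eq_zero (by simp [hij.symm]) (by simp [hij.symm])
  have z₃ : haarMoment i i j i = 0 := haarMoment_eq_zero (by simp [hij.symm]) (by simp [hij])
  have z₄ : haarMoment i j i i = 0 := haarMoment_eq_zero (by simp [hij]) (by simp [hij.symm])
  have z₅ : haarMoment i j j i = 0 := haarMoment_eq_zero (by simp [hij]) (by simp [hij])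
  have z₆ : haarMoment j i i j = 0 := haarMoment_eq_zero (by simp [hij.symm]) (by simp [hij.symm])
  have z₇ : haarMoment j j j i = 0 := haarMoment_eq_zero (by simp [hij.symm]) (by simp [hij.symm])
  have z₈ : haarMoment i j j j = 0 := haarMoment_eq_zero (by simp [hij]) (by simp [hij])
  have z₉ : haarMoment j i j j = 0 := haarMoment_eq_zero (by simp [hij.symm]) (by simp [hij])
  have z₁₀ : haarMoment j j i j = 0 := haarMoment_eq_zero (by simp [hij]) (by simp [hij.symm])
  rw [haarMoment_swap j i j i, haarMoment_swap i j i j, haarMoment_comm j i,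
    z₁, z₂, z₃, z₄, z₅, z₆, z₇, z₈, z₉, z₁₀] at h
  trans
  · refine Eq.trans ?_ h
    congr 1
    ext ψ
    simp only [star_add, star_mul, RCLike.star_def, Complex.conj_ofReal]
    ring
  · ring

/-- Phases never mix coordinates, so a further isometry is needed. The reflection fixing `2eᵢ + eⱼ`
has the rational matrix `(3, 4; 4, -3) / 5` on the plane of `eᵢ`, `eⱼ`; comparing `∫ |ψ|⁴` for
either coordinate before and after gives the relations, scaled by `5⁴`. -/
theorem haarMoment_rotate {n : ℕ} {i j : Bits n} (hij : i ≠ j) :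
    625 * haarMoment i i i i =
      81 * haarMoment i i i i + 256 * haarMoment j j j j + 576 * haarMoment i i j j ∧
    625 * haarMoment j j j j =
      256 * haarMoment i i i i + 81 * haarMoment j j j j + 576 * haarMoment i i j j := by
  let v : State n := EuclideanSpace.single i 2 + EuclideanSpace.single j 1
  let R : State n ≃ₗᵢ[ℂ] State n := (ℂ ∙ v).reflection
  have hv : ((‖v‖ : ℂ)) ^ 2 = 5 := by
    have : ‖v‖ ^ 2 = 5 := by
      rw [@norm_add_sq ℂ]
      simp [EuclideanSpace.inner_single_left, hij]
      norm_num
    exact_mod_cast this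
  have hR : ∀ (ψ : State n) k, R ψ k = 2 * ((2 * ψ i + ψ j) / 5 * v k) - ψ k := by
    intro ψ k
    simp only [R, Submodule.reflection_singleton_apply]
    erw [hv]
    have h2 : (starRingEnd ℂ) 2 = 2 := Complex.conj_ofNat 2
    simp [v, inner_add_left, EuclideanSpace.inner_single_left, h2]
    split_ifs <;> ring
  have hi : ∀ ψ : State n, R ψ i = ((3 / 5 : ℝ) : ℂ) * ψ i + ((4 / 5 : ℝ) : ℂ) * ψ j := by
    intro ψ
    rw [hR]
    simp [v, hij]
    ring
  have hj : ∀ ψ : State n, R ψ j = ((4 / 5 : ℝ) : ℂ) * ψ i + ((-3 / 5 : ℝ) : ℂ) * ψ j := by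
    intro ψ
    rw [hR]
    simp [v, hij.symm]
    ring
  let R' : State n ≃ₗᵢ[ℝ] State n :=
    { R.toLinearEquiv.restrictScalars ℝ with norm_map' := R.norm_map }
  have hR' : ∀ ψ, R' ψ = R ψ := fun _ => rfl
  have key : ∀ k, haarMoment k k k k = ∫ ψ : Metric.sphere (0 : State n) 1,
      star (R (ψ : State n) k) * R (ψ : State n) k * R (ψ : State n) k * star (R (ψ : State n) k)
        ∂(haarState n) := fun k =>
    (integral_haarState_comp_isometry R' (fun ψ => star (ψ k) * ψ k * ψ k * star (ψ k))).symm
  have h₁ := key i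
  have h₂ := key j
  simp only [hi] at h₁
  simp only [hj] at h₂
  rw [integral_haarState_two_coordinates hij] at h₁ h₂
  push_cast at h₁ h₂
  constructor
  · linear_combination 625 * h₁
  · linear_combination 625 * h₂

/-- All fourth-order moments are determined by a single constant. -/
theorem exists_haarMoment_eq (n : ℕ) : ∃ b : ℂ, ∀ i j k l : Bits n, haarMoment i j k l =
    b * ((if i = j ∧ k = l then 1 else 0) + (if i = k ∧ j = l then 1 else 0)) := by
  have h2 : ∀ i j : Bits n, i ≠ j → haarMoment i i i i = 2 * haarMoment i i j j ∧
      haarMoment j j j j = haarMoment i i i i := by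
    intro i j hij
    obtain ⟨h₁, h₂⟩ := haarMoment_rotate hij
    have h : haarMoment j j j j = haarMoment i i i i := by
      linear_combination (1 / 800 : ℂ) * (h₂ - h₁)
    exact ⟨by linear_combination (1 / 288 : ℂ) * h₁ + (256 / 288 : ℂ) * h, h⟩
  have hall : ∀ i j : Bits n, haarMoment i i i i = haarMoment j j j j := by
    intro i j
    by_cases hij : i = j
    · rw [hij]
    · exact (h2 i j hij).2.symm
  -- Halved because both pairings hold when all four indices agree.
  refine ⟨haarMoment (n := n) 0 0 0 0 / 2, fun i j k l => ?_⟩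
  by_cases h₁ : i = j ∧ k = l
  · obtain ⟨rfl, rfl⟩ := h₁
    by_cases h : i = k
    · subst h
      rw [hall i 0]; simp; ring
    · rw [hall 0 i, (h2 i k h).1]
      simp [h]
  · by_cases h₂ : i = k ∧ j = l
    · obtain ⟨rfl, rfl⟩ := h₂
      have h : i ≠ j := fun h => h₁ ⟨h, h⟩
      rw [haarMoment_swap, hall 0 i, (h2 i j h).1]
      simp [h]
    · rw [haarMoment_eq_zero h₁ h₂]; simp [h₁, h₂]

theorem sum_mul_haarMoment {n : ℕ} {b : ℂ} (hb : ∀ i j k l : Bits n, haarMoment i j k l =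
    b * ((if i = j ∧ k = l then 1 else 0) + (if i = k ∧ j = l then 1 else 0))) (M : Op n) :
    ∫ ψ : Metric.sphere (0 : State n) 1, ∑ i, ∑ j, ∑ k, ∑ l, M i j * star (M k l) *
      (star ((ψ : State n) i) * (ψ : State n) j * (ψ : State n) k * star ((ψ : State n) l))
        ∂(haarState n) =
      b * (M.trace * star M.trace + (M.conjTranspose * M).trace) := by
  have h := integral_haarState_quartic (n := n) id (fun i j k l => M i j * star (M k l))
  simp only [id] at h
  rw [h]
  simp only [hb, ite_and, mul_add, Finset.sum_add_distrib, mul_ite, mul_one, mul_zero,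
    Finset.sum_ite_eq, Finset.mem_univ, if_true, Finset.sum_ite_irrel, Finset.sum_const_zero]
  congr 1
  · simp only [Matrix.trace, Matrix.diag, star_sum]
    rw [Finset.sum_mul_sum, Finset.mul_sum]
    simp only [Finset.mul_sum]
    exact Finset.sum_congr rfl fun i _ => Finset.sum_congr rfl fun j _ => by ring
  · rw [Matrix.trace]
    simp only [Matrix.diag, Matrix.mul_apply, Matrix.conjTranspose_apply, Finset.mul_sum]
    rw [Finset.sum_comm]
    exact Finset.sum_congr rfl fun i _ => Finset.sum_congr rfl fun j _ => by ring

theorem norm_inner_sq_eq_sum {n : ℕ} (U₁ U₂ : Op n) (ψ : State n) :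
    ((‖inner ℂ (Matrix.toEuclideanCLM (n := Bits n) (𝕜 := ℂ) U₁ ψ)
      (Matrix.toEuclideanCLM (n := Bits n) (𝕜 := ℂ) U₂ ψ)‖ ^ 2 : ℝ) : ℂ) =
      ∑ i, ∑ j, ∑ k, ∑ l, (U₁.conjTranspose * U₂) i j * star ((U₁.conjTranspose * U₂) k l) *
        (star (ψ i) * ψ j * ψ k * star (ψ l)) := by
  have hin : inner ℂ (Matrix.toEuclideanCLM (n := Bits n) (𝕜 := ℂ) U₁ ψ)
      (Matrix.toEuclideanCLM (n := Bits n) (𝕜 := ℂ) U₂ ψ) =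
      ∑ i, ∑ j, (U₁.conjTranspose * U₂) i j * (star (ψ i) * ψ j) := by
    rw [EuclideanSpace.inner_eq_star_dotProduct, Matrix.ofLp_toEuclideanCLM,
      Matrix.ofLp_toEuclideanCLM, dotProduct_comm, Matrix.star_mulVec, ← Matrix.dotProduct_mulVec,
      Matrix.mulVec_mulVec]
    simp only [dotProduct, Matrix.mulVec, Finset.mul_sum]
    exact Finset.sum_congr rfl fun i _ => Finset.sum_congr rfl fun j _ => by
      simp only [Pi.star_apply]; ring
  have hsq : ∀ z : ℂ, ((‖z‖ ^ 2 : ℝ) : ℂ) = z * star z := by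
    intro z
    rw [RCLike.star_def, Complex.mul_conj, Complex.normSq_eq_norm_sq]
  rw [hsq, hin]
  simp only [star_sum, Finset.sum_mul]
  simp only [Finset.mul_sum]
  refine Finset.sum_congr rfl fun i _ => Finset.sum_congr rfl fun j _ => Finset.sum_congr rfl fun k _ =>
    Finset.sum_congr rfl fun l _ => ?_
  simp only [star_mul, star_star]
  ring

/-- The Haar-averaged fidelity of two unitaries in terms of their Hilbert-Schmidt overlap. -/
theorem averageFidelity_eq {n : ℕ} {U₁ U₂ : Op n}
    (h₁ : U₁ ∈ Matrix.unitaryGroup (Bits n) ℂ) (h₂ : U₂ ∈ Matrix.unitaryGroup (Bits n) ℂ) :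
    averageFidelity U₁ U₂ =
      (‖(U₁.conjTranspose * U₂).trace‖ ^ 2 + 2 ^ n) / (2 ^ n * (2 ^ n + 1)) := by
  obtain ⟨b, hb⟩ := exists_haarMoment_eq n
  have := isProbabilityMeasure_haarState n
  have key : ∀ V₁ V₂ : Op n, V₁ ∈ Matrix.unitaryGroup (Bits n) ℂ →
      V₂ ∈ Matrix.unitaryGroup (Bits n) ℂ → (averageFidelity V₁ V₂ : ℂ) =
        b * ((‖(V₁.conjTranspose * V₂).trace‖ ^ 2 + 2 ^ n : ℝ) : ℂ) := by
    intro V₁ V₂ hV₁ hV₂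
    have hM : (V₁.conjTranspose * V₂).conjTranspose * (V₁.conjTranspose * V₂) = 1 := by
      rw [Matrix.conjTranspose_mul, Matrix.conjTranspose_conjTranspose, Matrix.mul_assoc,
        ← Matrix.mul_assoc V₁]
      erw [Unitary.mul_star_self_of_mem hV₁]
      rw [Matrix.one_mul]
      exact Unitary.star_mul_self_of_mem hV₂
    have h := sum_mul_haarMoment hb (V₁.conjTranspose * V₂)
    rw [hM] at h
    rw [averageFidelity, ← integral_complex_ofReal]
    simp only [norm_inner_sq_eq_sum]
    rw [h]
    congr 1
    rw [RCLike.star_def, Complex.mul_conj, Complex.normSq_eq_norm_sq]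
    simp
  -- Normalization: for the identity the overlap is `d`, so `1 = b (d² + d)`.
  have hone : averageFidelity (1 : Op n) 1 = 1 := by
    simp only [averageFidelity, map_one]
    simp
  have k1 := key 1 1 (one_mem _) (one_mem _)
  rw [hone] at k1
  have hd : (0 : ℝ) < 2 ^ n := by positivity
  have hb' : b = ((1 / (2 ^ n * (2 ^ n + 1)) : ℝ) : ℂ) := by
    have hne : ((2 ^ n * (2 ^ n + 1) : ℝ) : ℂ) ≠ 0 := by
      exact_mod_cast (by positivity : (2 ^ n * (2 ^ n + 1) : ℝ) ≠ 0)
    rw [Complex.ofReal_div, eq_div_iff hne, Complex.ofReal_one, ← Complex.ofReal_one, k1]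
    congr 2
    simp
    ring
  have k2 := key U₁ U₂ h₁ h₂
  rw [hb', ← Complex.ofReal_mul] at k2
  rw [Complex.ofReal_inj.1 k2]
  ring

/-! ### Commuting orthogonal projections -/

section Projections

variable {E ι : Type*} [NormedAddCommGroup E] [InnerProductSpace ℂ E]

theorem norm_sq_eq_add_of_projection {P : E →ₗ[ℂ] E} (hs : P.IsSymmetric)
    (hi : ∀ x, P (P x) = P x) (x : E) : ‖x‖ ^ 2 = ‖P x‖ ^ 2 + ‖x - P x‖ ^ 2 := by
  have h : inner ℂ (P x) (x - P x) = 0 := by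
    rw [hs, map_sub, hi, sub_self, inner_zero_right]
  have := norm_add_sq_eq_norm_sq_add_norm_sq_of_inner_eq_zero (P x) (x - P x) h
  rw [add_sub_cancel] at this
  nlinarith

/-- Union bound for commuting orthogonal projections. -/
theorem exists_product_of_commuting_projections (P : ι → E →ₗ[ℂ] E)
    (hs : ∀ j, (P j).IsSymmetric) (hi : ∀ j x, P j (P j x) = P j x)
    (hc : ∀ j k x, P j (P k x) = P k (P j x)) (t : E → ℂ) (ht : ∀ j x, t (P j x) = t x)
    (S : Finset ι) :
    ∃ R : E →ₗ[ℂ] E, (∀ j ∈ S, ∀ x, P j (R x) = R x) ∧ (∀ j x, P j (R x) = R (P j x)) ∧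
      (∀ x, ‖R x‖ ≤ ‖x‖) ∧ (∀ x, t (R x) = t x) ∧
      ∀ x, ‖x‖ ^ 2 - ‖R x‖ ^ 2 ≤ ∑ j ∈ S, (‖x‖ ^ 2 - ‖P j x‖ ^ 2) := by
  classical
  induction S using Finset.induction_on with
  | empty => exact ⟨LinearMap.id, by simp⟩
  | insert k S hk ih =>
    obtain ⟨R, hfix, hcomm, hle, htr, hbd⟩ := ih
    have hP : ∀ x, ‖P k x‖ ≤ ‖x‖ := fun x => by
      have := norm_sq_eq_add_of_projection (hs k) (hi k) x
      exact (sq_le_sq₀ (norm_nonneg _) (norm_nonneg _)).1 (by nlinarith [sq_nonneg ‖x - P k x‖])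
    refine ⟨P k ∘ₗ R, ?_, ?_, ?_, ?_, ?_⟩
    · intro j hj x
      rcases Finset.mem_insert.1 hj with rfl | hj
      · exact hi _ _
      · simp only [LinearMap.comp_apply]
        rw [hc, hfix j hj]
    · intro j x
      simp only [LinearMap.comp_apply]
      rw [hc, hcomm]
    · exact fun x => (hP _).trans (hle x)
    · intro x
      simp only [LinearMap.comp_apply, ht, htr]
    · intro x
      rw [Finset.sum_insert hk]
      have h₁ := norm_sq_eq_add_of_projection (hs k) (hi k) (R x)
      have h₂ := norm_sq_eq_add_of_projection (hs k) (hi k) x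
      -- Here commutation matters: the part of `R x` lost under `P k` is the image under the
      -- contraction `R` of the part of `x` lost.
      have h₃ : ‖R x - P k (R x)‖ ≤ ‖x - P k x‖ := by
        rw [hcomm, ← map_sub]; exact hle _
      have h₄ := pow_le_pow_left₀ (norm_nonneg _) h₃ 2
      have h₅ := hbd x
      simp only [LinearMap.comp_apply]
      linarith

end Projections

/-! ### Hilbert-Schmidt geometry of operators -/

/-- An operator as a vector of the Hilbert-Schmidt space. -/
def vec {n : ℕ} : Op n →ₗ[ℂ] EuclideanSpace ℂ (Bits n × Bits n) where
  toFun M := WithLp.toLp 2 fun p => M p.1 p.2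
  map_add' _ _ := rfl
  map_smul' _ _ := rfl

@[simp] theorem vec_apply {n : ℕ} (M : Op n) (p : Bits n × Bits n) : vec M p = M p.1 p.2 := rfl

theorem norm_vec_sq {n : ℕ} (M : Op n) : ‖vec M‖ ^ 2 = ∑ i, ∑ j, ‖M i j‖ ^ 2 := by
  rw [EuclideanSpace.norm_sq_eq, Fintype.sum_prod_type]
  rfl

theorem norm_vec_sq_eq_trace {n : ℕ} (M : Op n) :
    ((‖vec M‖ ^ 2 : ℝ) : ℂ) = (M.conjTranspose * M).trace := by
  rw [norm_vec_sq, Finset.sum_comm]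
  push_cast
  simp only [Matrix.trace, Matrix.diag, Matrix.mul_apply, Matrix.conjTranspose_apply]
  refine Finset.sum_congr rfl fun i _ => Finset.sum_congr rfl fun j _ => ?_
  rw [mul_comm, RCLike.star_def, Complex.mul_conj, Complex.normSq_eq_norm_sq]
  simp

/-- The bit string with only bit `j` set. -/
abbrev bit {n : ℕ} (j : Fin n) : Bits n := Pi.single j 1

theorem add_bit_bit {n : ℕ} (j : Fin n) (x : Bits n) : x + bit j + bit j = x := by
  rw [add_assoc, ← Pi.single_add]
  have : (1 + 1 : Fin 2) = 0 := rfl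
  rw [this, Pi.single_zero, add_zero]

/-- The orthogonal projection `M ↦ 𝟙 / 2 ⊗ Tr_j M` onto the operators acting trivially on
qubit `j`. -/
def depolarize {n : ℕ} (j : Fin n) :
    EuclideanSpace ℂ (Bits n × Bits n) →ₗ[ℂ] EuclideanSpace ℂ (Bits n × Bits n) where
  toFun v := WithLp.toLp 2 fun p =>
    if p.1 j = p.2 j then (v p + v (p.1 + bit j, p.2 + bit j)) / 2 else 0
  map_add' v w := by
    ext p
    simp only [PiLp.add_apply]
    split_ifs <;> ring
  map_smul' c v := by
    ext p
    simp only [PiLp.smul_apply, smul_eq_mul, RingHom.id_apply]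
    split_ifs <;> ring

theorem depolarize_apply {n : ℕ} (j : Fin n) (v : EuclideanSpace ℂ (Bits n × Bits n))
    (p : Bits n × Bits n) : depolarize j v p =
      if p.1 j = p.2 j then (v p + v (p.1 + bit j, p.2 + bit j)) / 2 else 0 := rfl

theorem depolarize_depolarize {n : ℕ} (j : Fin n) (v : EuclideanSpace ℂ (Bits n × Bits n)) :
    depolarize j (depolarize j v) = depolarize j v := by
  ext p
  simp only [depolarize_apply, Pi.add_apply, add_left_inj, add_bit_bit, Prod.mk.eta]
  split_ifs <;> ring

theorem depolarize_comm {n : ℕ} (j k : Fin n) (v : EuclideanSpace ℂ (Bits n × Bits n)) :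
    depolarize j (depolarize k v) = depolarize k (depolarize j v) := by
  ext p
  simp only [depolarize_apply, Pi.add_apply, add_left_inj]
  rw [add_right_comm p.1 (bit j), add_right_comm p.2 (bit j)]
  split_ifs <;> ring

theorem depolarize_isSymmetric {n : ℕ} (j : Fin n) :
    (depolarize j : EuclideanSpace ℂ (Bits n × Bits n) →ₗ[ℂ] _).IsSymmetric := by
  intro v w
  -- Flipping bit `j` in both indices is an involution preserving the condition `p.1 j = p.2 j`; it
  -- moves the shift from one vector to the other.
  let σ : Bits n × Bits n ≃ Bits n × Bits n :=
    (Equiv.addRight (bit j)).prodCongr (Equiv.addRight (bit j))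
  have hσ : ∀ p, σ p = (p.1 + bit j, p.2 + bit j) := fun _ => rfl
  have h := Equiv.sum_comp σ fun p : Bits n × Bits n =>
    if p.1 j = p.2 j then w p * star (v (p.1 + bit j, p.2 + bit j)) / 2 else 0
  simp only [hσ, Pi.add_apply, add_left_inj, add_bit_bit, Prod.mk.eta] at h
  simp only [PiLp.inner_apply, depolarize_apply]
  trans ∑ p : Bits n × Bits n, ((if p.1 j = p.2 j then w p * star (v p) / 2 else 0) +
    if p.1 j = p.2 j then w p * star (v (p.1 + bit j, p.2 + bit j)) / 2 else 0)
  · refine Finset.sum_congr rfl fun p _ => ?_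
    have h2 : (starRingEnd ℂ) 2 = 2 := Complex.conj_ofNat 2
    split_ifs
    · simp [h2]; ring
    · simp
  · rw [Finset.sum_add_distrib, ← h, ← Finset.sum_add_distrib]
    refine Finset.sum_congr rfl fun p _ => ?_
    split_ifs
    · simp; ring
    · simp

theorem sum_diag_depolarize {n : ℕ} (j : Fin n) (v : EuclideanSpace ℂ (Bits n × Bits n)) :
    ∑ x, depolarize j v (x, x) = ∑ x, v (x, x) := by
  simp only [depolarize_apply, if_true]
  have h := Equiv.sum_comp (Equiv.addRight (bit j)) fun x => v (x, x)
  simp only [Equiv.coe_addRight] at h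
  rw [← Finset.sum_div, Finset.sum_add_distrib, h]
  ring

theorem eq_zero_of_depolarize_eq {n : ℕ} {v : EuclideanSpace ℂ (Bits n × Bits n)}
    (h : ∀ j, depolarize j v = v) {x y : Bits n} (hxy : x ≠ y) : v (x, y) = 0 := by
  obtain ⟨j, hj⟩ := Function.ne_iff.1 hxy
  rw [← h j, depolarize_apply, if_neg hj]

theorem diag_eq_of_depolarize_eq {n : ℕ} {v : EuclideanSpace ℂ (Bits n × Bits n)}
    (h : ∀ j, depolarize j v = v) (x : Bits n) : v (x, x) = v (0, 0) := by
  have hstep : ∀ j (y : Bits n), v (y + bit j, y + bit j) = v (y, y) := by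
    intro j y
    have := congrArg (fun w : EuclideanSpace ℂ (Bits n × Bits n) => w (y, y)) (h j)
    simp only [depolarize_apply, if_true] at this
    linear_combination 2 * this
  have hsingle : ∀ j (a : Fin 2) (y : Bits n),
      v (y + Pi.single j a, y + Pi.single j a) = v (y, y) := by
    intro j a y
    fin_cases a
    · simp
    · exact hstep j y
  have hsum : ∀ S : Finset (Fin n),
      v (∑ j ∈ S, Pi.single j (x j), ∑ j ∈ S, Pi.single j (x j)) = v (0, 0) := by
    intro S
    induction S using Finset.induction_on with
    | empty => simp
    | insert k S hk ih => rw [Finset.sum_insert hk, add_comm, hsingle, ih]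
  simpa [Finset.univ_sum_single] using hsum Finset.univ

theorem card_bits (n : ℕ) : Fintype.card (Bits n) = 2 ^ n := by simp

/-- The common fixed vectors are the scalar operators `c · 1`, with squared norm `d |c|²` and trace
`d c`. -/
theorem norm_sq_of_depolarize_eq {n : ℕ} {v : EuclideanSpace ℂ (Bits n × Bits n)}
    (h : ∀ j, depolarize j v = v) : ‖v‖ ^ 2 = ‖∑ x, v (x, x)‖ ^ 2 / 2 ^ n := by
  have h₁ : ‖v‖ ^ 2 = 2 ^ n * ‖v (0, 0)‖ ^ 2 := by
    rw [EuclideanSpace.norm_sq_eq, Fintype.sum_prod_type]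
    trans ∑ x : Bits n, ‖v (0, 0)‖ ^ 2
    · refine Finset.sum_congr rfl fun x _ => ?_
      rw [Finset.sum_eq_single x, diag_eq_of_depolarize_eq h]
      · intro y _ hy
        rw [eq_zero_of_depolarize_eq h hy.symm]; simp
      · simp
    · rw [Finset.sum_const, Finset.card_univ, card_bits]; simp
  simp only [diag_eq_of_depolarize_eq h, Finset.sum_const, Finset.card_univ, card_bits, h₁]
  rw [nsmul_eq_mul, norm_mul]
  have : (0 : ℝ) < 2 ^ n := by positivity
  simp
  field_simp

/-- The global overlap deficit of an operator is at most the sum of the local ones. -/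
theorem norm_vec_sq_sub_trace_le {n : ℕ} (M : Op n) :
    ‖vec M‖ ^ 2 - ‖M.trace‖ ^ 2 / 2 ^ n ≤
      ∑ j, (‖vec M‖ ^ 2 - ‖depolarize j (vec M)‖ ^ 2) := by
  obtain ⟨R, hfix, -, -, htr, hbd⟩ := exists_product_of_commuting_projections
    (E := EuclideanSpace ℂ (Bits n × Bits n)) depolarize depolarize_isSymmetric
    depolarize_depolarize depolarize_comm (fun v => ∑ x, v (x, x)) sum_diag_depolarize Finset.univ
  have h := hbd (vec M)
  rw [norm_sq_of_depolarize_eq fun j => hfix j (Finset.mem_univ j) (vec M), htr] at h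
  exact h

/-! ### The local cost bounds the global overlap -/

theorem splitQubit_symm_add_bit {n : ℕ} (j : Fin n) (a : Fin 2)
    (r : {k : Fin n // k ≠ j} → Fin 2) :
    (splitQubit j).symm (a, r) + bit j = (splitQubit j).symm (a + 1, r) := by
  rw [Equiv.eq_symm_apply]
  refine Prod.ext ?_ ?_
  · simp [splitQubit, Equiv.funSplitAt, Equiv.piSplitAt]
  · funext k
    have hk := k.2
    simp [splitQubit, Equiv.funSplitAt, Equiv.piSplitAt, hk]

theorem splitQubit_symm_apply_self {n : ℕ} (j : Fin n) (a : Fin 2)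
    (r : {k : Fin n // k ≠ j} → Fin 2) : (splitQubit j).symm (a, r) j = a := by
  simp [splitQubit, Equiv.funSplitAt, Equiv.piSplitAt]

theorem sum_bits_eq_sum_split {n : ℕ} {A : Type*} [AddCommMonoid A] (j : Fin n) (f : Bits n → A) :
    ∑ x, f x = ∑ r, ∑ a, f ((splitQubit j).symm (a, r)) := by
  rw [← Equiv.sum_comp (splitQubit j).symm, Fintype.sum_prod_type_right]

/-- The nonzero entries are halves of entries of `Tr_j M`, each occurring once per value of bit `j`:
hence `2 · 1/4 = 1/2`. -/
theorem norm_depolarize_vec_sq {n : ℕ} (j : Fin n) (M : Op n) :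
    ‖depolarize j (vec M)‖ ^ 2 = (∑ r, ∑ s, ‖∑ a, M ((splitQubit j).symm (a, r))
      ((splitQubit j).symm (a, s))‖ ^ 2) / 2 := by
  have h1 : (1 + 1 : Fin 2) = 0 := rfl
  have hterm : ∀ (r s : {k : Fin n // k ≠ j} → Fin 2) (a b : Fin 2),
      ‖depolarize j (vec M) ((splitQubit j).symm (a, r), (splitQubit j).symm (b, s))‖ ^ 2 =
        if a = b then ‖∑ a, M ((splitQubit j).symm (a, r)) ((splitQubit j).symm (a, s))‖ ^ 2 / 4
        else 0 := by
    intro r s a b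
    rw [depolarize_apply]
    simp only [splitQubit_symm_apply_self, splitQubit_symm_add_bit, vec_apply, Fin.sum_univ_two]
    by_cases hab : a = b
    · subst hab
      rw [if_pos rfl, if_pos rfl, norm_div, div_pow]
      have h2 : ‖(2 : ℂ)‖ ^ 2 = 4 := by norm_num
      rw [h2]
      fin_cases a
      · simp
      · simp [h1, add_comm]
    · rw [if_neg hab, if_neg hab]; simp
  rw [EuclideanSpace.norm_sq_eq, Fintype.sum_prod_type, sum_bits_eq_sum_split j, Finset.sum_div]
  refine Finset.sum_congr rfl fun r _ => ?_
  simp_rw [sum_bits_eq_sum_split j (fun y => ‖depolarize j (vec M) (_, y)‖ ^ 2), hterm]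
  rw [Finset.sum_comm, Finset.sum_div]
  refine Finset.sum_congr rfl fun s _ => ?_
  simp only [Finset.sum_ite_eq, Finset.mem_univ, if_true, Finset.sum_const, Finset.card_univ,
    Fintype.card_fin, nsmul_eq_mul]
  push_cast
  ring

/-- The blocks of the Bell projector are half matrix units, so the entanglement fidelity only sees
the `(b, a)` entry of the channel applied to the unit at `(b, a)`. -/
theorem mul_padMaximallyMixed_mul {n : ℕ} (j : Fin n) (M : Op n) (a b : Fin 2) :
    partialTraceOthers j (M * padMaximallyMixed j (Matrix.single b a 1) * M.conjTranspose) b a =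
      (1 / 2 ^ (n - 1)) * ∑ r, ∑ s, M ((splitQubit j).symm (b, r)) ((splitQubit j).symm (b, s)) *
        star (M ((splitQubit j).symm (a, r)) ((splitQubit j).symm (a, s))) := by
  simp only [partialTraceOthers, Matrix.of_apply, Finset.mul_sum]
  refine Finset.sum_congr rfl fun r _ => ?_
  rw [Matrix.mul_apply, ← Equiv.sum_comp (splitQubit j).symm, Fintype.sum_prod_type,
    Finset.sum_eq_single a]
  · refine Finset.sum_congr rfl fun s _ => ?_
    rw [Matrix.mul_apply, ← Equiv.sum_comp (splitQubit j).symm, Fintype.sum_prod_type,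
      Finset.sum_eq_single b, Finset.sum_eq_single s]
    · simp [padMaximallyMixed, Matrix.kroneckerMap_apply]; ring
    · intro t _ ht
      simp [padMaximallyMixed, Matrix.kroneckerMap_apply, Matrix.one_apply_ne ht]
    · simp
    · intro c _ hc
      refine Finset.sum_eq_zero fun t _ => ?_
      simp [padMaximallyMixed, Matrix.kroneckerMap_apply, hc.symm]
    · simp
  · intro c _ hc
    refine Finset.sum_eq_zero fun t _ => ?_
    rw [Matrix.mul_apply, Finset.sum_eq_zero, zero_mul]
    intro y _
    simp [padMaximallyMixed, Matrix.kroneckerMap_apply, hc.symm]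
  · simp

theorem bellProjector_apply (p q : Fin 2 × Fin 2) :
    bellProjector p q = if p.1 = p.2 ∧ q.1 = q.2 then 1 / 2 else 0 := by
  have h : ((Real.sqrt 2 : ℂ))⁻¹ * ((Real.sqrt 2 : ℂ))⁻¹ = 1 / 2 := by
    rw [← mul_inv, ← Complex.ofReal_mul, Real.mul_self_sqrt (by norm_num)]; simp
  simp only [bellProjector, Matrix.vecMulVec_apply, Pi.star_apply]
  by_cases h₁ : p.1 = p.2 <;> by_cases h₂ : q.1 = q.2 <;> simp [h₁, h₂]
  simpa using h

theorem bellProjector_block (b a : Fin 2) :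
    (Matrix.of fun s t => bellProjector (s, b) (t, a)) =
      (1 / 2 : ℂ) • (Matrix.single b a 1 : Matrix (Fin 2) (Fin 2) ℂ) := by
  ext s t
  simp [bellProjector_apply, Matrix.single_apply, eq_comm]

/-- The local entanglement fidelity as a squared Hilbert-Schmidt norm. -/
theorem entanglementFidelity_eq {n : ℕ} (U V : Op n) (j : Fin n) :
    entanglementFidelity U V j = ‖depolarize j (vec (U * V.conjTranspose))‖ ^ 2 / 2 ^ n := by
  set M := U * V.conjTranspose with hM
  have hch : ∀ ρ, localChannel U V j ρ =
      partialTraceOthers j (M * padMaximallyMixed j ρ * M.conjTranspose) := by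
    intro ρ
    rw [hM, Matrix.conjTranspose_mul, Matrix.conjTranspose_conjTranspose]
    rfl
  have htr : (bellProjector * ampliate (localChannel U V j) bellProjector).trace =
      ∑ a, ∑ b, (1 / 4 : ℂ) * localChannel U V j (Matrix.single b a 1) b a := by
    simp only [Matrix.trace, Matrix.diag, Matrix.mul_apply, Fintype.sum_prod_type, ampliate,
      Matrix.of_apply, bellProjector_block, map_smul, Matrix.smul_apply, smul_eq_mul]
    simp [bellProjector_apply, Fin.sum_univ_two]
    ring
  rw [entanglementFidelity, htr]
  simp only [hch, mul_padMaximallyMixed_mul]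
  rw [norm_depolarize_vec_sq]
  -- The truncated `n - 1` is harmless: a qubit `j` exists, so `n ≥ 1`.
  have hn : (2 : ℝ) ^ n = 2 * 2 ^ (n - 1) := by
    rw [← pow_succ', Nat.sub_add_cancel (Nat.one_le_iff_ne_zero.2 (by have := j.2; omega))]
  rw [hn, ← Complex.ofReal_re (_ / _)]
  congr 1
  push_cast
  simp only [← Complex.ofReal_pow]
  have hsq : ∀ z : ℂ, ((‖z‖ ^ 2 : ℝ) : ℂ) = z * star z := by
    intro z
    rw [RCLike.star_def, Complex.mul_conj, Complex.normSq_eq_norm_sq]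
  simp only [hsq, Fin.sum_univ_two, star_add, mul_add, add_mul, Finset.sum_add_distrib]
  field_simp
  ring

/-- The Hilbert-Schmidt test is bounded by `n` times its local version. -/
theorem one_sub_overlap_le_cost {n : ℕ} (hn : 0 < n) {U V : Op n}
    (hU : U ∈ Matrix.unitaryGroup (Bits n) ℂ) (hV : V ∈ Matrix.unitaryGroup (Bits n) ℂ) :
    1 - (‖(U * V.conjTranspose).trace‖ / 2 ^ n) ^ 2 ≤ n * costLHST U V := by
  have hd : (0 : ℝ) < 2 ^ n := by positivity
  have hM : (U * V.conjTranspose).conjTranspose * (U * V.conjTranspose) = 1 :=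
    Unitary.star_mul_self_of_mem (mul_mem hU (Unitary.star_mem hV))
  have hnorm : ‖vec (U * V.conjTranspose)‖ ^ 2 = 2 ^ n := by
    have := norm_vec_sq_eq_trace (U * V.conjTranspose)
    rw [hM, Matrix.trace_one, card_bits] at this
    exact_mod_cast this
  have h := norm_vec_sq_sub_trace_le (U * V.conjTranspose)
  rw [hnorm] at h
  have hn' : (n : ℝ) ≠ 0 := by positivity
  have hcost : n * costLHST U V =
      (∑ j, ((2 : ℝ) ^ n - ‖depolarize j (vec (U * V.conjTranspose))‖ ^ 2)) / 2 ^ n := by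
    simp only [costLHST, entanglementFidelity_eq, Finset.sum_sub_distrib, Finset.sum_const,
      Finset.card_univ, Fintype.card_fin, nsmul_eq_mul, ← Finset.sum_div]
    field_simp
  rw [hcost, le_div_iff₀ hd]
  refine le_trans (le_of_eq ?_) h
  field_simp

/-! ### Hilbert-Schmidt distance of unitaries -/

theorem conjTranspose_mul_self_of_unitary {n : ℕ} {A : Op n}
    (hA : A ∈ Matrix.unitaryGroup (Bits n) ℂ) : A.conjTranspose * A = 1 :=
  Unitary.star_mul_self_of_mem hA

theorem norm_vec_unitary_mul {n : ℕ} {A : Op n} (hA : A ∈ Matrix.unitaryGroup (Bits n) ℂ)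
    (X : Op n) : ‖vec (A * X)‖ = ‖vec X‖ := by
  rw [← sq_eq_sq₀ (norm_nonneg _) (norm_nonneg _), ← Complex.ofReal_inj, norm_vec_sq_eq_trace,
    norm_vec_sq_eq_trace, Matrix.conjTranspose_mul, Matrix.mul_assoc, ← Matrix.mul_assoc _ A,
    conjTranspose_mul_self_of_unitary hA, Matrix.one_mul]

theorem norm_vec_mul_unitary {n : ℕ} {A : Op n} (hA : A ∈ Matrix.unitaryGroup (Bits n) ℂ)
    (X : Op n) : ‖vec (X * A)‖ = ‖vec X‖ := by
  rw [← sq_eq_sq₀ (norm_nonneg _) (norm_nonneg _), ← Complex.ofReal_inj, norm_vec_sq_eq_trace,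
    norm_vec_sq_eq_trace, Matrix.conjTranspose_mul, Matrix.mul_assoc, Matrix.trace_mul_comm,
    Matrix.mul_assoc, Matrix.mul_assoc]
  have h : A * A.conjTranspose = 1 := Unitary.mul_star_self_of_mem hA
  rw [h, Matrix.mul_one]

/-- Telescoping: each replacement of one factor `A` by `B` costs the same, since the surrounding
unitaries preserve the Hilbert-Schmidt norm. -/
theorem norm_vec_pow_sub_pow_le {n : ℕ} {A B : Op n} (hA : A ∈ Matrix.unitaryGroup (Bits n) ℂ)
    (hB : B ∈ Matrix.unitaryGroup (Bits n) ℂ) (N : ℕ) :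
    ‖vec (A ^ N - B ^ N)‖ ≤ N * ‖vec (A - B)‖ := by
  induction N with
  | zero => simp
  | succ k ih =>
    have h : A ^ (k + 1) - B ^ (k + 1) = A ^ k * (A - B) + (A ^ k - B ^ k) * B := by
      rw [pow_succ, pow_succ, mul_sub, sub_mul]; abel
    rw [h, map_add]
    refine (norm_add_le _ _).trans ?_
    rw [norm_vec_unitary_mul (pow_mem hA k), norm_vec_mul_unitary hB]
    push_cast
    linarith

theorem norm_vec_sub_sq {n : ℕ} {A B : Op n} (hA : A ∈ Matrix.unitaryGroup (Bits n) ℂ)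
    (hB : B ∈ Matrix.unitaryGroup (Bits n) ℂ) :
    ‖vec (A - B)‖ ^ 2 = 2 * (2 ^ n - (A.conjTranspose * B).trace.re) := by
  have h := norm_vec_sq_eq_trace (A - B)
  have hBA : (B.conjTranspose * A).trace = star (A.conjTranspose * B).trace := by
    rw [← Matrix.trace_conjTranspose, Matrix.conjTranspose_mul, Matrix.conjTranspose_conjTranspose]
  rw [Matrix.conjTranspose_sub, Matrix.sub_mul, Matrix.mul_sub, Matrix.mul_sub,
    conjTranspose_mul_self_of_unitary hA, conjTranspose_mul_self_of_unitary hB, Matrix.trace_sub,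
    Matrix.trace_sub, Matrix.trace_sub, hBA, Matrix.trace_one, card_bits] at h
  have h' := congrArg Complex.re h
  have hpow : ((2 : ℂ) ^ n).re = 2 ^ n := by
    rw [← Complex.ofReal_ofNat, ← Complex.ofReal_pow, Complex.ofReal_re]
  rw [Complex.ofReal_re] at h'
  simp [hpow] at h'
  rw [map_sub, h']
  ring

theorem two_mul_le_norm_vec_sub_sq {n : ℕ} {A B : Op n}
    (hA : A ∈ Matrix.unitaryGroup (Bits n) ℂ) (hB : B ∈ Matrix.unitaryGroup (Bits n) ℂ) :
    2 * (2 ^ n - ‖(A.conjTranspose * B).trace‖) ≤ ‖vec (A - B)‖ ^ 2 := by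
  rw [norm_vec_sub_sq hA hB]
  linarith [Complex.re_le_norm (A.conjTranspose * B).trace]

theorem smul_mem_unitaryGroup {n : ℕ} {A : Op n} (hA : A ∈ Matrix.unitaryGroup (Bits n) ℂ)
    {c : ℂ} (hc : ‖c‖ = 1) : c • A ∈ Matrix.unitaryGroup (Bits n) ℂ := by
  rw [Matrix.mem_unitaryGroup_iff'] at hA ⊢
  rw [star_smul, Matrix.smul_mul, Matrix.mul_smul, hA, smul_smul, RCLike.star_def,
    ← Complex.normSq_eq_conj_mul_self, Complex.normSq_eq_norm_sq, hc]
  simp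

/-- An optimal global phase turns the Hilbert-Schmidt distance into the overlap. -/
theorem exists_phase_norm_vec_sub_sq {n : ℕ} {A B : Op n}
    (hA : A ∈ Matrix.unitaryGroup (Bits n) ℂ) (hB : B ∈ Matrix.unitaryGroup (Bits n) ℂ) :
    ∃ c : ℂ, ‖c‖ = 1 ∧
      ‖vec (A - c • B)‖ ^ 2 = 2 * (2 ^ n - ‖(A.conjTranspose * B).trace‖) := by
  obtain ⟨c, hc, hcz⟩ : ∃ c : ℂ, ‖c‖ = 1 ∧
      c * (A.conjTranspose * B).trace = ‖(A.conjTranspose * B).trace‖ := by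
    generalize (A.conjTranspose * B).trace = z
    by_cases hz : z = 0
    · exact ⟨1, by simp, by simp [hz]⟩
    · have hz' : (‖z‖ : ℂ) ≠ 0 := by simpa using hz
      refine ⟨star z / ‖z‖, ?_, ?_⟩
      · simp [hz]
      · rw [div_mul_eq_mul_div, RCLike.star_def, ← Complex.normSq_eq_conj_mul_self,
          Complex.normSq_eq_norm_sq, div_eq_iff hz']
        push_cast; ring
  refine ⟨c, hc, ?_⟩
  rw [norm_vec_sub_sq hA (smul_mem_unitaryGroup hB hc), Matrix.mul_smul, Matrix.trace_smul,
    smul_eq_mul, hcz, Complex.ofReal_re]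

/-- The squared distance at the optimal phase is nonnegative. -/
theorem norm_trace_le {n : ℕ} {A B : Op n}
    (hA : A ∈ Matrix.unitaryGroup (Bits n) ℂ) (hB : B ∈ Matrix.unitaryGroup (Bits n) ℂ) :
    ‖(A.conjTranspose * B).trace‖ ≤ 2 ^ n := by
  obtain ⟨c, -, h⟩ := exists_phase_norm_vec_sub_sq hA hB
  nlinarith [sq_nonneg ‖vec (A - c • B)‖]

theorem operatorNorm_nonneg {n : ℕ} (X : Op n) : 0 ≤ operatorNorm X := norm_nonneg _

/-- Each of the `d` columns is the image of a unit basis vector. -/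
theorem norm_vec_le_operatorNorm {n : ℕ} (X : Op n) :
    ‖vec X‖ ≤ Real.sqrt (2 ^ n) * operatorNorm X := by
  have hcol : ∀ j, ∑ i, ‖X i j‖ ^ 2 ≤ operatorNorm X ^ 2 := by
    intro j
    have h := (Matrix.toEuclideanCLM (n := Bits n) (𝕜 := ℂ) X).le_opNorm (EuclideanSpace.single j 1)
    have h1 : ‖(EuclideanSpace.single j 1 : State n)‖ = 1 := by simp
    rw [h1, mul_one] at h
    have h2 := pow_le_pow_left₀ (norm_nonneg _) h 2
    rw [EuclideanSpace.norm_sq_eq] at h2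
    simpa [Matrix.ofLp_toEuclideanCLM, operatorNorm] using h2
  rw [← sq_le_sq₀ (norm_nonneg _) (mul_nonneg (Real.sqrt_nonneg _) (operatorNorm_nonneg X)),
    mul_pow, Real.sq_sqrt (by positivity), norm_vec_sq, Finset.sum_comm]
  refine (Finset.sum_le_sum fun j _ => hcol j).trans ?_
  rw [Finset.sum_const, Finset.card_univ, card_bits, nsmul_eq_mul]
  push_cast
  exact le_rfl

/-! ### Evolution and ansatz -/

theorem evolution_mem_unitaryGroup {n : ℕ} {H : Op n} (hH : H.IsHermitian) (t : ℝ) :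
    evolution H t ∈ Matrix.unitaryGroup (Bits n) ℂ := by
  rw [Matrix.mem_unitaryGroup_iff', Matrix.star_eq_conjTranspose, evolution,
    ← Matrix.exp_conjTranspose, Matrix.conjTranspose_smul, hH.eq]
  have h : star (-(Complex.I * (t : ℂ))) • H = -((-(Complex.I * (t : ℂ))) • H) := by
    rw [← neg_smul]; congr 1; simp
  generalize (-(Complex.I * (t : ℂ))) • H = X at h ⊢
  have hX : Commute (-X) X := (Commute.refl X).neg_left
  rw [h, ← Matrix.exp_add_of_commute _ _ hX, neg_add_cancel, NormedSpace.exp_zero]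

theorem evolution_natCast_mul {n : ℕ} (H : Op n) (N : ℕ) (t : ℝ) :
    evolution H (N * t) = evolution H t ^ N := by
  rw [evolution, evolution, ← Matrix.exp_nsmul]
  congr 1
  rw [← Nat.cast_smul_eq_nsmul ℂ, smul_smul]
  congr 1
  push_cast; ring

theorem diagonalUnitary_mem_unitaryGroup {n : ℕ} (γ : Bits n → ℝ) :
    diagonalUnitary γ ∈ Matrix.unitaryGroup (Bits n) ℂ := by
  rw [Matrix.mem_unitaryGroup_iff', Matrix.star_eq_conjTranspose, diagonalUnitary,
    Matrix.diagonal_conjTranspose, Matrix.diagonal_mul_diagonal, ← Matrix.diagonal_one]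
  congr 1
  funext z
  rw [Pi.star_apply, RCLike.star_def, ← Complex.exp_conj, ← Complex.exp_add]
  simp

theorem ansatz_mem_unitaryGroup {n : ℕ} {W : Op n} (hW : W ∈ Matrix.unitaryGroup (Bits n) ℂ)
    (γ : Bits n → ℝ) : ansatz W γ ∈ Matrix.unitaryGroup (Bits n) ℂ :=
  mul_mem (mul_mem hW (diagonalUnitary_mem_unitaryGroup γ)) (Unitary.star_mem hW)

theorem diagonalUnitary_natCast_mul {n : ℕ} (γ : Bits n → ℝ) (N : ℕ) :
    diagonalUnitary (fun z => N * γ z) = diagonalUnitary γ ^ N := by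
  rw [diagonalUnitary, diagonalUnitary, Matrix.diagonal_pow]
  congr 1
  funext z
  rw [Pi.pow_apply, ← Complex.exp_nat_mul]
  congr 1
  push_cast; ring

theorem ansatz_natCast_mul {n : ℕ} {W : Op n} (hW : W ∈ Matrix.unitaryGroup (Bits n) ℂ)
    (γ : Bits n → ℝ) (N : ℕ) : ansatz W (fun z => N * γ z) = ansatz W γ ^ N := by
  rw [ansatz, diagonalUnitary_natCast_mul]
  induction N with
  | zero =>
    rw [pow_zero, pow_zero, Matrix.mul_one]
    exact Unitary.mul_star_self_of_mem hW
  | succ k ih =>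
    rw [pow_succ (ansatz W γ), ← ih, ansatz, pow_succ]
    simp only [Matrix.mul_assoc]
    rw [← Matrix.mul_assoc W.conjTranspose W, conjTranspose_mul_self_of_unitary hW, Matrix.one_mul]

/-! ### Error accumulation -/

theorem norm_trace_mul_conjTranspose {n : ℕ} (U V : Op n) :
    ‖(U * V.conjTranspose).trace‖ = ‖(U.conjTranspose * V).trace‖ := by
  rw [← norm_star, ← Matrix.trace_conjTranspose, Matrix.conjTranspose_mul,
    Matrix.conjTranspose_conjTranspose, Matrix.trace_mul_comm]

/-- The overlap deficit after `N` steps is at most `N` times the one-step error. -/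
theorem sqrt_one_sub_overlap_pow_le {n : ℕ} (hn : 0 < n) {A U V : Op n}
    (hA : A ∈ Matrix.unitaryGroup (Bits n) ℂ) (hU : U ∈ Matrix.unitaryGroup (Bits n) ℂ)
    (hV : V ∈ Matrix.unitaryGroup (Bits n) ℂ) (N : ℕ) :
    Real.sqrt (1 - ‖((A ^ N).conjTranspose * V ^ N).trace‖ / 2 ^ n) ≤
      N * stepError n (operatorNorm (A - U)) (costLHST U V) := by
  have hd : (0 : ℝ) < 2 ^ n := by positivity
  have h2d : (0 : ℝ) < 2 * 2 ^ n := by positivity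
  -- The phase is optimized for one step only; after `N` steps it becomes `c ^ N`, which does not
  -- change the modulus of the overlap.
  obtain ⟨c, hc, hcUV⟩ := exists_phase_norm_vec_sub_sq hU hV
  have hcV := smul_mem_unitaryGroup hV hc
  have h₁ : 2 * 2 ^ n * (1 - ‖((A ^ N).conjTranspose * V ^ N).trace‖ / 2 ^ n) ≤
      ‖vec (A ^ N - (c • V) ^ N)‖ ^ 2 := by
    have h := two_mul_le_norm_vec_sub_sq (pow_mem hA N) (pow_mem hcV N)
    have hcN : ‖((A ^ N).conjTranspose * (c • V) ^ N).trace‖ =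
        ‖((A ^ N).conjTranspose * V ^ N).trace‖ := by
      rw [smul_pow, Matrix.mul_smul, Matrix.trace_smul, norm_smul, norm_pow, hc, one_pow, one_mul]
    rw [hcN] at h
    refine le_trans (le_of_eq ?_) h
    field_simp
  have h₂ : ‖vec (A - c • V)‖ ≤ ‖vec (A - U)‖ + ‖vec (U - c • V)‖ := by
    rw [← sub_add_sub_cancel A U, map_add]
    exact norm_add_le _ _
  have h₃ : ‖vec (U - c • V)‖ ≤
      Real.sqrt (2 * 2 ^ n) * Real.sqrt (1 - Real.sqrt (1 - n * costLHST U V)) := by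
    rw [← Real.sqrt_mul h2d.le]
    refine Real.le_sqrt_of_sq_le ?_
    rw [hcUV]
    have hs : Real.sqrt (1 - n * costLHST U V) ≤ ‖(U.conjTranspose * V).trace‖ / 2 ^ n := by
      refine Real.sqrt_le_iff.2 ⟨by positivity, ?_⟩
      have := one_sub_overlap_le_cost hn hU hV
      rw [norm_trace_mul_conjTranspose] at this
      linarith
    have hs' := mul_le_mul_of_nonneg_left hs h2d.le
    have : 2 * 2 ^ n * (‖(U.conjTranspose * V).trace‖ / 2 ^ n) =
        2 * ‖(U.conjTranspose * V).trace‖ := by field_simp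
    linarith
  -- Rewriting `√d` as `√(2d) / √2` is the source of the `√2` under the Trotter error.
  have h₄ : ‖vec (A - U)‖ ≤ Real.sqrt (2 * 2 ^ n) * (operatorNorm (A - U) / Real.sqrt 2) := by
    refine (norm_vec_le_operatorNorm _).trans (le_of_eq ?_)
    rw [Real.sqrt_mul (by norm_num)]
    field_simp
  have h₅ : ‖vec (A ^ N - (c • V) ^ N)‖ ≤ Real.sqrt (2 * 2 ^ n) *
      (N * stepError n (operatorNorm (A - U)) (costLHST U V)) := by
    refine (norm_vec_pow_sub_pow_le hA hcV N).trans ?_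
    rw [stepError, mul_left_comm]
    refine mul_le_mul_of_nonneg_left ?_ (Nat.cast_nonneg N)
    rw [mul_add]
    linarith
  have h₆ := (Real.sqrt_le_sqrt h₁).trans_eq (Real.sqrt_sq (norm_nonneg _))
  rw [Real.sqrt_mul h2d.le] at h₆
  exact le_of_mul_le_mul_left (h₆.trans h₅) (Real.sqrt_pos.2 h2d)

theorem cost_nonneg {n : ℕ} (hn : 0 < n) {U V : Op n} (hU : U ∈ Matrix.unitaryGroup (Bits n) ℂ)
    (hV : V ∈ Matrix.unitaryGroup (Bits n) ℂ) : 0 ≤ n * costLHST U V := by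
  refine le_trans ?_ (one_sub_overlap_le_cost hn hU hV)
  rw [norm_trace_mul_conjTranspose, sub_nonneg]
  have hd : (0 : ℝ) < 2 ^ n := by positivity
  exact pow_le_one₀ (by positivity) ((div_le_one hd).2 (norm_trace_le hU hV))

/-! ### Real inequalities: from accumulated error to fidelity -/

theorem le_sq_of_sqrt_one_sub_le {t y : ℝ} (ht : 0 ≤ t) (hy : y ≤ 1)
    (h : Real.sqrt (1 - t) ≤ Real.sqrt (1 - Real.sqrt y)) : y ≤ t ^ 2 := by
  have hsy : Real.sqrt y ≤ 1 := Real.sqrt_le_one.2 hy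
  have h' := (Real.sqrt_le_sqrt_iff (sub_nonneg.2 hsy)).1 h
  exact (Real.sqrt_le_left ht).1 (by linarith)

/-- With `x = N²ε² ≤ 1` one has `t ≥ 1 - x ≥ 0`, so `t² ≥ (1 - x)² ≥ 1 - 2x`. The last bound uses `1
- √(1 - y) ≤ y` on `[0, 1]` with `y = n C`. -/
theorem fidelity_lower_bounds {n N : ℕ} {d εTS C ε F t : ℝ} (hdpos : 0 < d) (hε0 : 0 ≤ εTS)
    (hC0 : 0 ≤ n * C) (hε : ε = stepError n εTS C)
    (hFt : F = 1 / (d + 1) + d / (d + 1) * t ^ 2) (hcore : Real.sqrt (1 - t) ≤ N * ε)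
    (hnC : n * C ≤ 1) (hNε : N * ε ≤ 1) :
    F ≥ 1 / (d + 1) + d / (d + 1) * (1 - (N : ℝ) ^ 2 * ε ^ 2) ^ 2 ∧
    F ≥ 1 - (N : ℝ) ^ 2 * d / (d + 1) * (2 * ε ^ 2) ∧
    F ≥ 1 - (N : ℝ) ^ 2 * d / (d + 1) * (εTS + Real.sqrt (2 * n * C)) ^ 2 := by
  have h2 : (0 : ℝ) < Real.sqrt 2 := Real.sqrt_pos.2 (by norm_num)
  have hεnn : 0 ≤ ε := by rw [hε, stepError]; positivity
  have hdd : 0 ≤ d / (d + 1) := by positivity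
  have hone : 1 / (d + 1) + d / (d + 1) = 1 := by
    rw [← add_div, add_comm, div_self (by positivity)]
  have hq : 1 - t ≤ (N : ℝ) ^ 2 * ε ^ 2 := by
    have := (Real.sqrt_le_iff.1 hcore).2
    rwa [mul_pow] at this
  have hq1 : (N : ℝ) ^ 2 * ε ^ 2 ≤ 1 := by
    rw [← mul_pow]; exact pow_le_one₀ (by positivity) hNε
  have ht2 : (1 - (N : ℝ) ^ 2 * ε ^ 2) ^ 2 ≤ t ^ 2 :=
    pow_le_pow_left₀ (by linarith) (by linarith) 2
  have hF1 : 1 / (d + 1) + d / (d + 1) * (1 - (N : ℝ) ^ 2 * ε ^ 2) ^ 2 ≤ F := by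
    rw [hFt]; linarith [mul_le_mul_of_nonneg_left ht2 hdd]
  have hF2 : 1 - (N : ℝ) ^ 2 * d / (d + 1) * (2 * ε ^ 2) ≤ F := by
    refine le_trans ?_ hF1
    have h : 0 ≤ d / (d + 1) * ((N : ℝ) ^ 2 * ε ^ 2) ^ 2 := by positivity
    have e : (N : ℝ) ^ 2 * d / (d + 1) * (2 * ε ^ 2) =
        d / (d + 1) * (2 * ((N : ℝ) ^ 2 * ε ^ 2)) := by ring
    rw [e]
    nlinarith
  refine ⟨hF1, hF2, ?_⟩
  refine le_trans ?_ hF2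
  have hx : Real.sqrt (1 - Real.sqrt (1 - n * C)) ≤ Real.sqrt (n * C) := by
    refine Real.sqrt_le_sqrt ?_
    have : 1 - n * C ≤ Real.sqrt (1 - n * C) := Real.le_sqrt_of_sq_le (by nlinarith)
    linarith
  have hs : Real.sqrt 2 * ε ≤ εTS + Real.sqrt (2 * n * C) := by
    rw [mul_assoc, Real.sqrt_mul (by norm_num), hε, stepError, mul_add,
      mul_div_cancel₀ _ h2.ne']
    linarith [mul_le_mul_of_nonneg_left hx h2.le]
  have hs2 : 2 * ε ^ 2 ≤ (εTS + Real.sqrt (2 * n * C)) ^ 2 := by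
    have := pow_le_pow_left₀ (by positivity) hs 2
    rwa [mul_pow, Real.sq_sqrt (by norm_num)] at this
  have : 0 ≤ (N : ℝ) ^ 2 * d / (d + 1) := by positivity
  linarith [mul_le_mul_of_nonneg_left hs2 this]

theorem le_of_cost_le_threshold {n N : ℕ} (hn : 0 < n) (hN : 0 < N) {d εTS C ε F t f : ℝ}
    (hd : d = 2 ^ n) (hε0 : 0 ≤ εTS) (hε : ε = stepError n εTS C) (ht0 : 0 ≤ t)
    (hFt : F = 1 / (d + 1) + d / (d + 1) * t ^ 2) (hcore : Real.sqrt (1 - t) ≤ N * ε)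
    (hf0 : 1 / (d + 1) ≤ f) (hf1 : f ≤ 1)
    (hgapf : 1 / Real.sqrt 2 * εTS ≤ 1 / (N : ℝ) * fidelityGap n f)
    (hCf : C ≤ costThreshold n N εTS f) : f ≤ F := by
  have hdpos : 0 < d := hd ▸ by positivity
  have hNpos : (0 : ℝ) < N := Nat.cast_pos.2 hN
  have hnpos : (0 : ℝ) < n := Nat.cast_pos.2 hn
  have hdd : 0 ≤ d / (d + 1) := by positivity
  have hg0 : 0 ≤ fidelityGap n f := Real.sqrt_nonneg _
  have hg1 : fidelityGap n f ≤ 1 := by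
    refine Real.sqrt_le_one.2 ?_
    linarith [Real.sqrt_nonneg (1 - ((2 : ℝ) ^ n + 1) / 2 ^ n * (1 - f))]
  -- `δ` is the per-step error budget left after the Trotter error; the threshold is the cost at
  -- which `√(1 - √(1 - n C))` equals `δ`.
  obtain ⟨δ, hδ⟩ : ∃ δ, δ = 1 / (N : ℝ) * fidelityGap n f - 1 / Real.sqrt 2 * εTS := ⟨_, rfl⟩
  have hδ0 : 0 ≤ δ := by rw [hδ]; linarith
  have hδ1 : δ ≤ 1 := by
    have h1 : 1 / (N : ℝ) ≤ 1 := (div_le_one hNpos).2 (by exact_mod_cast hN)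
    have h3 : 0 ≤ 1 / Real.sqrt 2 * εTS := by positivity
    rw [hδ]
    nlinarith [mul_le_mul h1 hg1 hg0 zero_le_one]
  have hδ2 : δ ^ 2 ≤ 1 := pow_le_one₀ hδ0 hδ1
  rw [costThreshold, ← hδ] at hCf
  have hnC : n * C ≤ 1 - (1 - δ ^ 2) ^ 2 := by
    have := mul_le_mul_of_nonneg_left hCf hnpos.le
    rwa [← mul_assoc, mul_one_div_cancel hnpos.ne', one_mul] at this
  have hsq : 1 - δ ^ 2 ≤ Real.sqrt (1 - n * C) := Real.le_sqrt_of_sq_le (by linarith)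
  have hsδ : Real.sqrt (1 - Real.sqrt (1 - n * C)) ≤ δ :=
    Real.sqrt_le_iff.2 ⟨hδ0, by linarith⟩
  have hstep : N * ε ≤ fidelityGap n f := by
    have h : ε ≤ 1 / (N : ℝ) * fidelityGap n f := by
      rw [hε, stepError]
      have : εTS / Real.sqrt 2 = 1 / Real.sqrt 2 * εTS := by ring
      linarith
    have := mul_le_mul_of_nonneg_left h hNpos.le
    rwa [← mul_assoc, mul_one_div_cancel hNpos.ne', one_mul] at this
  have hle := hcore.trans hstep
  rw [fidelityGap, ← hd] at hle
  -- `y` is the squared overlap corresponding to fidelity `f`, so `G(f) = √(1 - √y)`, to be compared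
  -- with `√(1 - t)`.
  obtain ⟨y, hy⟩ : ∃ y, y = 1 - (d + 1) / d * (1 - f) := ⟨_, rfl⟩
  have hfy : f = 1 / (d + 1) + d / (d + 1) * y := by rw [hy]; field_simp; ring
  have hy0 : 0 ≤ y := by
    have h : 0 ≤ d / (d + 1) * y := by linarith
    exact nonneg_of_mul_nonneg_right h (by positivity)
  have hy1 : y ≤ 1 := by
    have : 0 ≤ (d + 1) / d * (1 - f) := mul_nonneg (by positivity) (by linarith)
    linarith
  rw [← hy] at hle
  have hyt : y ≤ t ^ 2 := le_sq_of_sqrt_one_sub_le ht0 hy1 hle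
  rw [hfy, hFt]
  linarith [mul_le_mul_of_nonneg_left hyt hdd]

end VFF

end

/-! ### Assembly in terms of the normalized overlap -/

theorem mainTheorem2 (n : ℕ) (hn : 0 < n) (N : ℕ) (hN : 0 < N)
    (H : VFF.Op n) (hH : H.IsHermitian) (Δt : ℝ)
    (U : VFF.Op n) (hU : U ∈ Matrix.unitaryGroup (VFF.Bits n) ℂ)
    (W : VFF.Op n) (hW : W ∈ Matrix.unitaryGroup (VFF.Bits n) ℂ)
    (γ : VFF.Bits n → ℝ)
    (d εTS C ε F : ℝ)
    (hd : d = 2 ^ n)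
    (hεTS : εTS = VFF.trotterError H Δt U)
    (hC : C = VFF.costLHST U (VFF.ansatz W γ))
    (hε : ε = VFF.stepError n εTS C)
    (hF : F = VFF.averageFidelity (VFF.evolution H (N * Δt))
      (VFF.ansatz W (fun z => N * γ z))) :
    -- the average fidelity lies in the range where the expression `G` is real
    (1 / (d + 1) ≤ F ∧ F ≤ 1) ∧
    -- the bound on `G(T)`
    (n * C ≤ 1 →
      VFF.fidelityGap n F ≤
        N / Real.sqrt 2 * εTS + N * Real.sqrt (1 - Real.sqrt (1 - n * C))) ∧
    -- the lower bounds on the average fidelity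
    (n * C ≤ 1 → N * ε ≤ 1 →
      F ≥ 1 / (d + 1) + d / (d + 1) * (1 - (N : ℝ) ^ 2 * ε ^ 2) ^ 2 ∧
      F ≥ 1 - (N : ℝ) ^ 2 * d / (d + 1) * (2 * ε ^ 2) ∧
      F ≥ 1 - (N : ℝ) ^ 2 * d / (d + 1) * (εTS + Real.sqrt (2 * n * C)) ^ 2) ∧
    -- the termination condition for a target fidelity `f`
    (∀ f : ℝ, 1 / (d + 1) ≤ f → f ≤ 1 →
      1 / Real.sqrt 2 * εTS ≤ 1 / (N : ℝ) * VFF.fidelityGap n f →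
      C ≤ VFF.costThreshold n N εTS f → f ≤ F) := by
  have hA := VFF.evolution_mem_unitaryGroup hH Δt
  have hV := VFF.ansatz_mem_unitaryGroup hW γ
  rw [VFF.evolution_natCast_mul, VFF.ansatz_natCast_mul hW,
    VFF.averageFidelity_eq (pow_mem hA N) (pow_mem hV N), ← hd] at hF
  have hcore := VFF.sqrt_one_sub_overlap_pow_le hn hA hU hV N
  have hεTS' : VFF.operatorNorm (VFF.evolution H Δt - U) = εTS := hεTS.symm
  rw [hεTS', ← hC, ← hε, ← hd] at hcore
  have hC0 := VFF.cost_nonneg hn hU hV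
  rw [← hC] at hC0
  have htr := VFF.norm_trace_le (pow_mem hA N) (pow_mem hV N)
  rw [← hd] at htr
  have hε0 : 0 ≤ εTS := hεTS' ▸ VFF.operatorNorm_nonneg _
  have hdpos : 0 < d := hd ▸ by positivity
  obtain ⟨t, ht⟩ : ∃ t, t =
    ‖((VFF.evolution H Δt ^ N).conjTranspose * VFF.ansatz W γ ^ N).trace‖ / d := ⟨_, rfl⟩
  have ht0 : 0 ≤ t := ht ▸ by positivity
  have ht1 : t ≤ 1 := ht ▸ (div_le_one hdpos).2 htr
  have hFt : F = 1 / (d + 1) + d / (d + 1) * t ^ 2 := by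
    rw [hF, ht]; field_simp; ring
  rw [← ht] at hcore
  have hgap : VFF.fidelityGap n F = Real.sqrt (1 - t) := by
    have : 1 - (d + 1) / d * (1 - F) = t ^ 2 := by rw [hFt]; field_simp; ring
    rw [VFF.fidelityGap, ← hd, this, Real.sqrt_sq ht0]
  have hdd : 0 ≤ d / (d + 1) := by positivity
  have hone : 1 / (d + 1) + d / (d + 1) = 1 := by rw [← add_div, add_comm, div_self (by positivity)]
  refine ⟨⟨?_, ?_⟩, ?_, ?_, ?_⟩
  · rw [hFt]; nlinarith [sq_nonneg t, mul_nonneg hdd (sq_nonneg t)]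
  · rw [hFt]; nlinarith [pow_le_one₀ ht0 ht1 (n := 2)]
  · intro _
    rw [hgap]
    refine hcore.trans (le_of_eq ?_)
    rw [hε, VFF.stepError]; ring
  · exact VFF.fidelity_lower_bounds hdpos hε0 hC0 hε hFt hcore
  · exact fun f => VFF.le_of_cost_le_threshold hn hN hd hε0 hε ht0 hFt hcore
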